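/- **Proposition 2.3.** All rings are commutative with identity. Let $k$ be a field and let $A$ and $B$ be $k$-algebras such that the ring $A\otimes_k B$ is Noetherian. Let $P$ be a prime ideal of $A\otimes_k B$, let $p=P\cap A$ and $q=P\cap B$ be its inverse images under the canonical homomorphisms $A\to A\otimes_k B$, $a\mapsto a\otimes 1$, and $B\to A\otimes_k B$, $b\mapsto 1\otimes b$, and let $p\otimes_k B+A\otimes_k q$ denote the ideal of $A\otimes_k B$ generated by the images of $p$ and $q$. Write $\mathrm{ht}$ for the height of an ideal, and, for a proper ideal $I$ of a Noetherian ring $R$, write $G(I)$ for the grade of $I$, i.e. the common length of all maximal $R$-sequences (regular sequences) in $I$. Then (a) $\mathrm{ht}(P)=\mathrm{ht}(p)+\mathrm{ht}(q)+\mathrm{ht}\!\left(\dfrac{P}{p\otimes_k B+A\otimes_k q}\right)$; (b) $G\big(P(A\otimes_k B)_P\big)=G(pA_p)+G(qB_q)+\mathrm{ht}\!\left(\dfrac{P}{p\otimes_k B+A\otimes_k q}\right)$, where the last term is the height of the image of $P$ in the quotient ring $(A\otimes_k B)/(p\otimes_k B+A\otimes_k q)$, and the three grades are taken in the localizations $(A\otimes_k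 B)_P$, $A_p$ and $B_q$ respectively. -/

import Mathlib

/-- `rs` is a maximal `A`-sequence in the ideal `I`: a (proper) regular sequence on the ring `A`
all of whose terms lie in `I`, and which cannot be continued by a further element of `I`. -/
structure IsMaximalSequenceIn {A : Type*} [CommRing A] (I : Ideal A) (rs : List A) : Prop where
  isRegular : RingTheory.Sequence.IsRegular A rs
  mem : ∀ r ∈ rs, r ∈ I
  maximal : ∀ r ∈ I, ¬ RingTheory.Sequence.IsRegular A (rs ++ [r])

/-- `HasGrade I n`: the grade `G(I)` is (well defined and) equal to `n`, that is, maximal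
`A`-sequences in `I` exist and `n` is their common length. -/
structure HasGrade {A : Type*} [CommRing A] (I : Ideal A) (n : ℕ) : Prop where
  exists_maximal : ∃ rs : List A, IsMaximalSequenceIn I rs
  length_eq : ∀ rs : List A, IsMaximalSequenceIn I rs → rs.length = n

/-- The grade of an ideal is unique. -/
theorem HasGrade.unique {A : Type*} [CommRing A] {I : Ideal A} {m n : ℕ}
    (hm : HasGrade I m) (hn : HasGrade I n) : m = n := by
  obtain ⟨rs, hrs⟩ := hm.exists_maximal
  exact (hm.length_eq rs hrs).symm.trans (hn.length_eq rs hrs)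

/-!
# Heights and grades of primes in a tensor product of algebras over a field

Everything rests on the flatness of `A → A ⊗ B` and of `B → A/p ⊗ B`. For a flat map `R → S` of
Noetherian rings and a prime `P` of `S` over `p`, both the height of `P` and the depth of `S_P` are
the sum of the corresponding invariants of `R` at `p` and of the fibre ring `S/pS` at the image
of `P`. Applied first to `A → A ⊗ B` and then to `B → A/p ⊗ B`, this gives the formula for the height
and, for the grade, the same formula with the last term replaced by the depth of the local ring of
`A/p ⊗ B/q` at the image of `P`. So it remains to see that this local ring is Cohen-Macaulay.

Additivity of the height is in Mathlib; additivity of the depth is `HasGrade.add_of_flat`. That all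
maximal regular sequences have the same length (`IsMaximalSequenceIn.hasGrade`) follows from Mathlib's
theorem of Rees, so it suffices to exhibit one maximal sequence of the right length, maximality being
detected by a socle element (`isMaximalSequenceIn_maximalIdeal_iff`). The main point is that an
element `y` regular on the closed fibre is regular on `S/IS` for every ideal `I` of `R`
(`mem_map_of_mul_mem_map_of_flat`), whence `S/yS` is again flat over `R`.

For the Cohen-Macaulay property, the prime meets `A/p` and `B/q` only in zero, so `A/p ⊗ B/q` may be
replaced by its localization `K ⊗ L`, with `K` and `L` the fraction fields
(`isCohenMacaulayAt_tensorProduct_of_comap_eq_bot`). A prime of `K ⊗ L` is finitely generated, hence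
extended from `K₀ ⊗ L` with `K₀` finitely generated over `k`, and this reduces the question to `K₀`
(`isCohenMacaulayAt_tensorProduct`). Finally `K₀` is reached by adjoining one element at a time, and
each step is a flat map whose fibres have local rings with principal maximal ideals
(`isCohenMacaulayAt_of_flat_of_forall_exists_eval₂`); a Noetherian local ring with principal maximal
ideal is Cohen-Macaulay.
-/

/-! ### Regular sequences and depth in Noetherian local rings -/

section

open IsLocalRing RingTheory.Sequence CategoryTheory Abelian Limits Pointwise

universe u

/-- If `Ext^i(κ, M) = 0` for all `i < n`, where `κ` is the residue field, then every `M`-regular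
sequence of length `< n` in the maximal ideal can be continued: dividing out one element lowers the
range of vanishing by one, and at the end `Hom(κ, M') = 0` gives an `M'`-regular element. -/
theorem exists_isRegular_append_of_subsingleton_ext {R : Type u} [CommRing R]
    [IsNoetherianRing R] [IsLocalRing R] (M : ModuleCat.{u} R) [Module.Finite R M] [Nontrivial M]
    (n : ℕ) (hn : ∀ i < n, Subsingleton (Ext (ModuleCat.of R (ResidueField R)) M i))
    (rs : List R) (hrs : IsRegular M rs) (mem : ∀ r ∈ rs, r ∈ maximalIdeal R)
    (hlen : rs.length < n) :
    ∃ r ∈ maximalIdeal R, IsRegular M (rs ++ [r]) := by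
  induction rs generalizing M n with
  | nil =>
    have hlt : maximalIdeal R • (⊤ : Submodule R M) < ⊤ :=
      (Submodule.top_ne_ideal_smul_of_le_jacobson_annihilator
        (maximalIdeal_le_jacobson _)).symm.lt_top
    have hsupp : Module.support R (ResidueField R) =
        PrimeSpectrum.zeroLocus (maximalIdeal R : Set R) := by
      rw [Module.support_eq_zeroLocus]
      congr 2
      exact Ideal.annihilator_quotient
    obtain ⟨l, hl, hmem, hreg⟩ := ModuleCat.exists_isRegular_of_exists_subsingleton_ext
      (maximalIdeal R) 1 M hlt (ModuleCat.of R (ResidueField R)) hsupp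
      (fun i hi => hn i (by simp at hlen; omega))
    obtain ⟨r, rfl⟩ := List.length_eq_one_iff.mp hl
    exact ⟨r, hmem r (by simp), hreg⟩
  | cons x rs ih =>
    rw [isRegular_cons_iff] at hrs
    have := nontrivial_quotSMulTop_of_mem_maximalIdeal M (mem x (by simp))
    obtain ⟨n, rfl⟩ : ∃ k, n = k + 1 := ⟨n - 1, by omega⟩
    obtain ⟨r, hr, h⟩ := ih (ModuleCat.of R (QuotSMulTop x M)) n (fun i hi => by
        have z1 := AddCommGrpCat.isZero_of_iff_subsingleton.mpr (hn i (by omega))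
        have z2 := AddCommGrpCat.isZero_of_iff_subsingleton.mpr (hn (i + 1) (by omega))
        exact AddCommGrpCat.subsingleton_of_isZero <| ShortComplex.Exact.isZero_of_both_zeros
          ((Ext.covariant_sequence_exact₃' _ hrs.1.smulShortComplex_shortExact) i (i + 1) rfl)
          (z1.eq_zero_of_src _) (z2.eq_zero_of_tgt _)) hrs.2
        (fun r hr => mem r (by simp [hr])) (by simpa using hlen)
    exact ⟨r, hr, by rw [List.cons_append, isRegular_cons_iff]; exact ⟨hrs.1, h⟩⟩

/-- A regular sequence in the maximal ideal can be continued as long as there is a longer one: by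
the theorem of Rees the longer one forces enough groups `Ext^i(κ, R)` to vanish. -/
theorem exists_isRegular_append_of_length_lt {R : Type u} [CommRing R]
    [IsNoetherianRing R] [IsLocalRing R] {rs rs' : List R}
    (hrs : IsRegular R rs) (mem : ∀ r ∈ rs, r ∈ maximalIdeal R)
    (hrs' : IsRegular R rs') (mem' : ∀ r ∈ rs', r ∈ maximalIdeal R)
    (hlt : rs.length < rs'.length) :
    ∃ r ∈ maximalIdeal R, IsRegular R (rs ++ [r]) := by
  refine exists_isRegular_append_of_subsingleton_ext (ModuleCat.of R R) rs'.length
    (fun i hi => ?_) rs hrs mem hlt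
  refine ModuleCat.subsingleton_ext_of_exists_isRegular (maximalIdeal R)
    (ModuleCat.of R (ResidueField R)) ?_ (ModuleCat.of R R) ?_ rs' mem' hrs' i hi
  · rw [Module.support_eq_zeroLocus]
    refine PrimeSpectrum.zeroLocus_anti_mono ?_
    exact (Ideal.annihilator_quotient (I := maximalIdeal R)).ge
  · exact (Submodule.top_ne_ideal_smul_of_le_jacobson_annihilator
        (maximalIdeal_le_jacobson _)).symm.lt_top

theorem IsMaximalSequenceIn.hasGrade {R : Type*} [CommRing R]
    [IsNoetherianRing R] [IsLocalRing R] {rs : List R}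
    (h : IsMaximalSequenceIn (maximalIdeal R) rs) : HasGrade (maximalIdeal R) rs.length := by
  refine ⟨⟨rs, h⟩, fun rs' h' => ?_⟩
  rcases lt_trichotomy rs'.length rs.length with hlt | heq | hlt
  · obtain ⟨r, hr, hreg⟩ := exists_isRegular_append_of_length_lt h'.isRegular h'.mem
      h.isRegular h.mem hlt
    exact absurd hreg (h'.maximal r hr)
  · exact heq
  · obtain ⟨r, hr, hreg⟩ := exists_isRegular_append_of_length_lt h.isRegular h.mem
      h'.isRegular h'.mem hlt
    exact absurd hreg (h.maximal r hr)

theorem RingTheory.Sequence.IsRegular.length_le_ringKrullDim {R : Type*} [CommRing R]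
    [IsNoetherianRing R] [IsLocalRing R] {rs : List R} (h : IsRegular R rs) :
    (rs.length : WithBot ℕ∞) ≤ ringKrullDim R := by
  rw [← ringKrullDim_add_length_eq_ringKrullDim_of_isRegular rs h]
  have : Nontrivial (R ⧸ Ideal.ofList rs) := by
    rw [Ideal.Quotient.nontrivial_iff]
    have := h.top_ne_smul
    simpa [eq_comm] using this
  exact le_add_of_nonneg_left ringKrullDim_nonneg_of_nontrivial

/-- The depth of a Noetherian local ring exists, since regular sequences have length at most the
Krull dimension. -/
theorem exists_hasGrade_maximalIdeal (R : Type*) [CommRing R] [IsNoetherianRing R]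
    [IsLocalRing R] : ∃ n, HasGrade (maximalIdeal R) n := by
  by_contra! hcon
  have key : ∀ n : ℕ, ∃ rs : List R, rs.length = n ∧ IsRegular R rs ∧
      ∀ r ∈ rs, r ∈ maximalIdeal R := by
    intro n
    induction n with
    | zero => exact ⟨[], rfl, IsRegular.nil R R, by simp⟩
    | succ n ih =>
      obtain ⟨rs, hl, hr, hm⟩ := ih
      by_cases h : ∀ r ∈ maximalIdeal R, ¬ IsRegular R (rs ++ [r])
      · exact absurd (IsMaximalSequenceIn.hasGrade ⟨hr, hm, h⟩) (hcon _)
      · push Not at h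
        obtain ⟨r, hrm, hreg⟩ := h
        exact ⟨rs ++ [r], by simp [hl], hreg, by simpa [or_imp, forall_and] using ⟨hm, hrm⟩⟩
  have hfin : ringKrullDim R < ⊤ := ringKrullDim_lt_top
  obtain ⟨d, hd⟩ : ∃ d : ℕ, ringKrullDim R = d := by
    have h0 : 0 ≤ ringKrullDim R := ringKrullDim_nonneg_of_nontrivial
    induction h : ringKrullDim R using WithBot.recBotCoe with
    | bot => simp [h] at h0
    | coe x =>
      induction x using ENat.recTopCoe with
      | top => simp [h] at hfin
      | coe x => exact ⟨x, rfl⟩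
  obtain ⟨rs, hl, hr, hm⟩ := key (d + 1)
  have := IsRegular.length_le_ringKrullDim hr
  rw [hd, hl] at this
  norm_cast at this
  omega

/-- The sequence `y, ys` is weakly regular on `R ⧸ J` iff `y` is regular on `R ⧸ J` and `ys` is
weakly regular on `R ⧸ (J + (y))`; the first condition is phrased with elements. -/
theorem isWeaklyRegular_quotient_cons_iff {R : Type*} [CommRing R] (J : Ideal R) (y : R)
    (ys : List R) : IsWeaklyRegular (R ⧸ J) (y :: ys) ↔
      (∀ s, y * s ∈ J → s ∈ J) ∧ IsWeaklyRegular (R ⧸ (J ⊔ Ideal.span {y})) ys := by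
  rw [isWeaklyRegular_cons_iff]
  refine and_congr (isSMulRegular_quotient_iff_mem_of_smul_mem J y) ?_
  let e : QuotSMulTop y (R ⧸ J) ≃ₗ[R] R ⧸ (J ⊔ Ideal.span {y}) :=
    (Submodule.quotEquivOfEq _ ((y • (⊤ : Submodule R R)).map J.mkQ) (by
        rw [Submodule.map_pointwise_smul, Submodule.map_top, Submodule.range_mkQ])).trans
      ((Submodule.quotientQuotientEquivQuotientSup J (y • (⊤ : Submodule R R))).trans
        (Submodule.quotEquivOfEq _ _ (by
          rw [← Submodule.ideal_span_singleton_smul]; simp)))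
  exact e.isWeaklyRegular_congr ys

theorem isWeaklyRegular_quotient_append_singleton_iff {R : Type*} [CommRing R] (J : Ideal R)
    (ys : List R) (y : R) : IsWeaklyRegular (R ⧸ J) (ys ++ [y]) ↔
      IsWeaklyRegular (R ⧸ J) ys ∧
        ∀ s, y * s ∈ J ⊔ Ideal.ofList ys → s ∈ J ⊔ Ideal.ofList ys := by
  induction ys generalizing J with
  | nil => simp [isSMulRegular_quotient_iff_mem_of_smul_mem]
  | cons x ys ih =>
    rw [List.cons_append, isWeaklyRegular_quotient_cons_iff, isWeaklyRegular_quotient_cons_iff, ih,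
      and_assoc, Ideal.ofList_cons, sup_assoc]

theorem isWeaklyRegular_quotient_append_iff {R : Type*} [CommRing R] (J : Ideal R)
    (xs ys : List R) : IsWeaklyRegular (R ⧸ J) (xs ++ ys) ↔
      IsWeaklyRegular (R ⧸ J) xs ∧ IsWeaklyRegular (R ⧸ (J ⊔ Ideal.ofList xs)) ys := by
  induction xs generalizing J with
  | nil =>
    simpa using (Submodule.quotEquivOfEq J (J ⊔ Ideal.ofList []) (by simp)).isWeaklyRegular_congr ys
  | cons x xs ih =>
    rw [List.cons_append, isWeaklyRegular_quotient_cons_iff, isWeaklyRegular_quotient_cons_iff, ih,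
      and_assoc, Ideal.ofList_cons, sup_assoc]

theorem isWeaklyRegular_quotient_bot_iff {R : Type*} [CommRing R] (xs : List R) :
    IsWeaklyRegular (R ⧸ (⊥ : Ideal R)) xs ↔ IsWeaklyRegular R xs :=
  (Submodule.quotEquivOfEqBot (⊥ : Submodule R R) rfl).isWeaklyRegular_congr xs

/-- In a Noetherian local ring, a regular sequence in the maximal ideal is maximal iff the
quotient by it has a nonzero element killed by the maximal ideal. -/
theorem isMaximalSequenceIn_maximalIdeal_iff {R : Type*} [CommRing R]
    [IsNoetherianRing R] [IsLocalRing R] {rs : List R} :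
    IsMaximalSequenceIn (maximalIdeal R) rs ↔ IsWeaklyRegular R rs ∧
      (∀ r ∈ rs, r ∈ maximalIdeal R) ∧
      ∃ a, a ∉ Ideal.ofList rs ∧ ∀ r ∈ maximalIdeal R, r * a ∈ Ideal.ofList rs := by
  have append (r : R) : IsWeaklyRegular R (rs ++ [r]) ↔ IsWeaklyRegular R rs ∧
      ∀ s, r * s ∈ Ideal.ofList rs → s ∈ Ideal.ofList rs := by
    rw [← isWeaklyRegular_quotient_bot_iff, isWeaklyRegular_quotient_append_singleton_iff,
      isWeaklyRegular_quotient_bot_iff, bot_sup_eq]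
  constructor
  · rintro ⟨hreg, hmem, hmax⟩
    refine ⟨hreg.toIsWeaklyRegular, hmem, ?_⟩
    have h : ¬ Subsingleton (ResidueField R →ₗ[R] R ⧸ Ideal.ofList rs) := by
      rw [IsSMulRegular.subsingleton_linearMap_iff]
      rintro ⟨r, hr, hr'⟩
      replace hr : r ∈ maximalIdeal R := by
        rwa [show Module.annihilator R (ResidueField R) = maximalIdeal R from
          Ideal.annihilator_quotient] at hr
      refine hmax r hr ?_
      refine IsRegular.of_isWeaklyRegular_of_mem_maximalIdeal R
        (by simpa [or_imp, forall_and] using ⟨hmem, hr⟩) ?_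
      exact (append r).mpr ⟨hreg.toIsWeaklyRegular,
        (isSMulRegular_quotient_iff_mem_of_smul_mem _ r).mp hr'⟩
    rw [not_subsingleton_iff_nontrivial] at h
    obtain ⟨f, hf⟩ := exists_ne (0 : ResidueField R →ₗ[R] R ⧸ Ideal.ofList rs)
    obtain ⟨a, ha⟩ := Ideal.Quotient.mk_surjective (f 1)
    refine ⟨a, fun h => hf ?_, fun r hr => ?_⟩
    · have h1 : f 1 = 0 := by rw [← ha, Ideal.Quotient.eq_zero_iff_mem.mpr h]
      ext x
      obtain ⟨x, rfl⟩ := residue_surjective x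
      have : residue R x = x • (1 : ResidueField R) := by
        rw [Algebra.smul_def, mul_one]; rfl
      rw [this, map_smul, h1]; simp
    · rw [← Ideal.Quotient.eq_zero_iff_mem, map_mul, ha]
      have : f (r • 1) = r • f 1 := map_smul f r 1
      have h0 : r • (1 : ResidueField R) = 0 := by
        rw [Algebra.smul_def, mul_one]; exact (residue_eq_zero_iff r).mpr hr
      rw [h0, map_zero] at this
      rw [this, Algebra.smul_def]; rfl
  · rintro ⟨hreg, hmem, a, ha, ham⟩
    refine ⟨IsRegular.of_isWeaklyRegular_of_mem_maximalIdeal R hmem hreg, hmem,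
      fun r hr h => ha ?_⟩
    exact ((append r).mp h.toIsWeaklyRegular).2 a (ham r hr)

theorem isWeaklyRegular_map_of_surjective_iff {R S : Type*} [CommRing R] [CommRing S]
    (f : R →+* S) (hf : Function.Surjective f) (rs : List R) :
    IsWeaklyRegular S (rs.map f) ↔ IsWeaklyRegular (R ⧸ RingHom.ker f) rs := by
  algebraize [f]
  rw [show rs.map f = rs.map (algebraMap R S) from rfl, isWeaklyRegular_map_algebraMap_iff]
  exact ((Ideal.quotientKerAlgEquivOfSurjective
    (f := Algebra.ofId R S) hf).toLinearEquiv.isWeaklyRegular_congr rs).symm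

theorem IsMaximalSequenceIn.map_ringEquiv {R S : Type*} [CommRing R] [CommRing S] [IsLocalRing R]
    [IsLocalRing S] (e : R ≃+* S) {rs : List R}
    (h : IsMaximalSequenceIn (maximalIdeal R) rs) :
    IsMaximalSequenceIn (maximalIdeal S) (rs.map e) := by
  have hreg (xs : List R) : IsRegular R xs ↔ IsRegular S (xs.map e) := by
    refine AddEquiv.isRegular_congr (e := e.toAddEquiv) ?_
    rw [List.forall₂_map_right_iff, List.forall₂_same]
    intro x _ y
    exact map_mul e x y
  have hmem (x : R) : x ∈ maximalIdeal R ↔ e x ∈ maximalIdeal S := by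
    simp [mem_maximalIdeal]
  refine ⟨(hreg _).mp h.isRegular, ?_, ?_⟩
  · simpa [← hmem] using h.mem
  · intro s hs hs'
    obtain ⟨r, rfl⟩ := e.surjective s
    exact h.maximal r ((hmem r).mpr hs) ((hreg _).mpr (by simpa using hs'))

theorem HasGrade.of_ringEquiv {R S : Type*} [CommRing R] [CommRing S] [IsLocalRing R]
    [IsLocalRing S] (e : R ≃+* S) {n : ℕ} (h : HasGrade (maximalIdeal R) n) :
    HasGrade (maximalIdeal S) n := by
  obtain ⟨⟨rs, hrs⟩, hlen⟩ := h
  refine ⟨⟨_, hrs.map_ringEquiv e⟩, fun ss hss => ?_⟩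
  simpa using hlen _ (hss.map_ringEquiv e.symm)

end

/-! ### Depth along flat local homomorphisms -/

section

open IsLocalRing RingTheory.Sequence

theorem exists_sum_smul_eq_of_mem_map {R S : Type*} [CommRing R] [CommRing S] [Algebra R S]
    (I : Ideal R) {s : S} (hs : s ∈ I.map (algebraMap R S)) :
    ∃ (n : ℕ) (f : Fin n → R) (x : Fin n → S), (∀ i, f i ∈ I) ∧ ∑ i, f i • x i = s := by
  obtain ⟨n, x, g, rfl⟩ := Submodule.mem_span_set'.mp hs
  choose f hf hfg using fun i => (g i).2
  refine ⟨n, f, x, hf, Finset.sum_congr rfl fun i _ => ?_⟩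
  rw [Algebra.smul_def, hfg, smul_eq_mul, mul_comm]

/-- For a flat algebra `S` one has `(IS : a) = (I : a) S`; this is the nontrivial inclusion. -/
theorem mem_map_of_algebraMap_mul_mem_map_of_flat {R S : Type*} [CommRing R] [CommRing S]
    [Algebra R S] [Module.Flat R S] (I J : Ideal R) (a : R) (hJ : ∀ c, c * a ∈ I → c ∈ J) {s : S}
    (hs : algebraMap R S a * s ∈ I.map (algebraMap R S)) : s ∈ J.map (algebraMap R S) := by
  obtain ⟨n, f, x, hf, hfx⟩ := exists_sum_smul_eq_of_mem_map I hs
  have hrel : ∑ i, (Fin.cons a f : Fin (n + 1) → R) i •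
      (Fin.cons s (-x) : Fin (n + 1) → S) i = 0 := by
    rw [Fin.sum_univ_succ]
    simp [hfx, Algebra.smul_def a s]
  obtain ⟨k, c, y, hy, hc⟩ := Module.Flat.iff_forall_isTrivialRelation.mp ‹Module.Flat R S› hrel
  have h0 := hy 0
  simp only [Fin.cons_zero] at h0
  rw [h0]
  refine Ideal.sum_mem _ fun j _ => ?_
  rw [Algebra.smul_def]
  refine Ideal.mul_mem_right _ _ (Ideal.mem_map_of_mem _ (hJ _ ?_))
  have := hc j
  simp only [Fin.sum_univ_succ, Fin.cons_zero, Fin.cons_succ] at this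
  rw [mul_comm, eq_neg_of_add_eq_zero_left this]
  exact I.neg_mem (I.sum_mem fun i _ => I.mul_mem_right _ (hf i))

/-- Krull's intersection theorem: ideals of a Noetherian local ring are closed. -/
theorem mem_of_forall_mem_sup_maximalIdeal_pow {S : Type*} [CommRing S] [IsNoetherianRing S]
    [IsLocalRing S] {J : Ideal S} {s : S} (h : ∀ n : ℕ, s ∈ J ⊔ maximalIdeal S ^ n) : s ∈ J := by
  have hK := Ideal.iInf_pow_smul_eq_bot_of_isLocalRing (M := S ⧸ J) (maximalIdeal S)
    (Ideal.IsPrime.ne_top inferInstance)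
  rw [← Ideal.Quotient.eq_zero_iff_mem, ← Submodule.mem_bot (R := S), ← hK, Submodule.mem_iInf]
  intro n
  obtain ⟨j, hj, t, ht, rfl⟩ := Submodule.mem_sup.mp (h n)
  rw [map_add, Ideal.Quotient.eq_zero_iff_mem.mpr hj, zero_add]
  have : Ideal.Quotient.mk J t = t • (1 : S ⧸ J) := by
    rw [Algebra.smul_def, mul_one]; rfl
  rw [this]
  exact Submodule.smul_mem_smul ht trivial

theorem exists_notMem_forall_mul_mem_of_maximalIdeal_pow_le {R : Type*} [CommRing R]
    [IsLocalRing R] {I : Ideal R} (hI : I ≠ ⊤) {n : ℕ} (hn : maximalIdeal R ^ n ≤ I) :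
    ∃ a, a ∉ I ∧ ∀ r ∈ maximalIdeal R, r * a ∈ I := by
  induction n with
  | zero => exact absurd (by simpa using hn) hI
  | succ n ih =>
    by_cases h : maximalIdeal R ^ n ≤ I
    · exact ih h
    · obtain ⟨a, ha, haI⟩ := SetLike.not_le_iff_exists.mp h
      exact ⟨a, haI, fun r hr => hn (by rw [pow_succ']; exact Ideal.mul_mem_mul hr ha)⟩

theorem mem_maximalIdeal_of_mul_mem {R : Type*} [CommRing R] [IsLocalRing R] {I : Ideal R} {a : R}
    (ha : a ∉ I) {c : R} (hc : c * a ∈ I) : c ∈ maximalIdeal R := by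
  rw [mem_maximalIdeal, mem_nonunits_iff]
  exact fun hu => ha ((Ideal.unit_mul_mem_iff_mem I hu).mp hc)

theorem map_maximalIdeal_le (R S : Type*) [CommRing R] [CommRing S] [Algebra R S] [IsLocalRing R]
    [IsLocalRing S] [IsLocalHom (algebraMap R S)] :
    (maximalIdeal R).map (algebraMap R S) ≤ maximalIdeal S :=
  Ideal.map_le_iff_le_comap.mpr (maximalIdeal_comap (algebraMap R S)).ge

/-- Let `R → S` be a flat local homomorphism of Noetherian local rings. If `y` is regular on the
closed fibre `S ⧸ mS`, it is regular on `S ⧸ IS` for every ideal `I` of `R`. By Krull's intersection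
theorem `I` may be taken to contain a power of `m`; then one moves up to `I + (a)` with
`m a ⊆ I`, where flatness gives `(IS : a) = mS`. -/
theorem mem_map_of_mul_mem_map_of_flat {R S : Type*} [CommRing R] [CommRing S] [Algebra R S]
    [IsNoetherianRing R] [IsLocalRing R] [IsNoetherianRing S] [IsLocalRing S]
    [IsLocalHom (algebraMap R S)] [Module.Flat R S] {y : S}
    (hy : ∀ s, y * s ∈ (maximalIdeal R).map (algebraMap R S) →
      s ∈ (maximalIdeal R).map (algebraMap R S)) (I : Ideal R) {s : S}
    (hs : y * s ∈ I.map (algebraMap R S)) : s ∈ I.map (algebraMap R S) := by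
  have primary : ∀ (I : Ideal R) (n : ℕ), maximalIdeal R ^ n ≤ I → ∀ s : S,
      y * s ∈ I.map (algebraMap R S) → s ∈ I.map (algebraMap R S) := by
    intro I
    induction I using WellFoundedGT.induction with
    | ind I ih =>
    intro n hn s hs
    by_cases hI : I = ⊤
    · rw [hI, Ideal.map_top]; trivial
    obtain ⟨a, haI, ha⟩ := exists_notMem_forall_mul_mem_of_maximalIdeal_pow_le hI hn
    have hlt : I < I ⊔ Ideal.span {a} := by
      refine lt_of_le_of_ne le_sup_left fun h => haI ?_
      rw [h]
      exact (le_sup_right : _ ≤ I ⊔ Ideal.span {a}) (Ideal.mem_span_singleton_self a)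
    have h1 : s ∈ (I ⊔ Ideal.span {a}).map (algebraMap R S) :=
      ih _ hlt n (hn.trans le_sup_left) s (Ideal.map_mono le_sup_left hs)
    rw [Ideal.map_sup, Ideal.map_span, Set.image_singleton] at h1
    obtain ⟨i, hi, _, ht, rfl⟩ := Submodule.mem_sup.mp h1
    obtain ⟨t, rfl⟩ := Ideal.mem_span_singleton'.mp ht
    have h2 : algebraMap R S a * (y * t) ∈ I.map (algebraMap R S) := by
      have : algebraMap R S a * (y * t) = y * (i + t * algebraMap R S a) - y * i := by ring
      rw [this]
      exact Ideal.sub_mem _ hs (Ideal.mul_mem_left _ _ hi)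
    have h3 := hy t (mem_map_of_algebraMap_mul_mem_map_of_flat I _ a
      (fun c hc => mem_maximalIdeal_of_mul_mem haI hc) h2)
    have hle : Ideal.map (algebraMap R S) (maximalIdeal R * Ideal.span {a}) ≤
        I.map (algebraMap R S) := by
      refine Ideal.map_mono (Ideal.mul_le.mpr fun r hr b hb => ?_)
      obtain ⟨b, rfl⟩ := Ideal.mem_span_singleton'.mp hb
      have := I.mul_mem_left b (ha r hr)
      rwa [mul_left_comm] at this
    refine Ideal.add_mem _ hi (hle ?_)
    rw [Ideal.map_mul]
    exact Ideal.mul_mem_mul h3 (Ideal.mem_map_of_mem _ (Ideal.mem_span_singleton_self a))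
  refine mem_of_forall_mem_sup_maximalIdeal_pow fun n => ?_
  have := primary (I ⊔ maximalIdeal R ^ n) n le_sup_right s (Ideal.map_mono le_sup_left hs)
  rw [Ideal.map_sup, Ideal.map_pow] at this
  have hle : (maximalIdeal R).map (algebraMap R S) ≤ maximalIdeal S :=
    map_maximalIdeal_le R S
  exact (sup_le_sup le_rfl (Ideal.pow_right_mono hle n) :
    _ ≤ I.map (algebraMap R S) ⊔ maximalIdeal S ^ n) this

/-- If `S` is flat over `R` and `y` is regular on `S ⧸ IS` for every ideal `I`, then `S ⧸ yS` is
flat over `R`: a relation `∑ fᵢ xᵢ = y s` forces `s ∈ (f₁, …, fₗ) S`, so it can be corrected to a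
relation in `S`, which is trivial there. -/
theorem flat_quotient_span_singleton {R S : Type*} [CommRing R] [CommRing S] [Algebra R S]
    [Module.Flat R S] {y : S}
    (hy : ∀ (I : Ideal R) (s : S), y * s ∈ I.map (algebraMap R S) → s ∈ I.map (algebraMap R S)) :
    Module.Flat R (S ⧸ Ideal.span {y}) := by
  rw [Module.Flat.iff_forall_isTrivialRelation]
  intro l f x hfx
  choose x' hx' using fun i => Ideal.Quotient.mk_surjective (x i)
  have h1 : Ideal.Quotient.mk (Ideal.span {y}) (∑ i, f i • x' i) = 0 := by
    rw [← hfx, map_sum]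
    refine Finset.sum_congr rfl fun i _ => ?_
    rw [← hx', Algebra.smul_def, Algebra.smul_def, map_mul]; rfl
  obtain ⟨s, hs⟩ := Ideal.mem_span_singleton'.mp (Ideal.Quotient.eq_zero_iff_mem.mp h1)
  have hs' : s ∈ (Ideal.span (Set.range f)).map (algebraMap R S) := by
    refine hy _ s ?_
    rw [mul_comm, hs]
    refine Ideal.sum_mem _ fun i _ => ?_
    rw [Algebra.smul_def]
    exact Ideal.mul_mem_right _ _ (Ideal.mem_map_of_mem _ (Ideal.subset_span ⟨i, rfl⟩))
  obtain ⟨t, ht⟩ : ∃ t : Fin l → S, ∑ i, f i • t i = s := by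
    rw [Ideal.map_span, ← Set.range_comp] at hs'
    obtain ⟨c, hc⟩ := (Submodule.mem_span_range_iff_exists_fun S).mp hs'
    refine ⟨c, ?_⟩
    rw [← hc]
    exact Finset.sum_congr rfl fun i _ => by simp [Algebra.smul_def, mul_comm]
  have hrel : ∑ i, f i • (x' i - t i * y) = 0 := by
    simp only [smul_sub, Finset.sum_sub_distrib, ← smul_mul_assoc]
    rw [← Finset.sum_mul, ht, hs, sub_self]
  obtain ⟨k, c, z, hz, hc⟩ := Module.Flat.iff_forall_isTrivialRelation.mp ‹Module.Flat R S› hrel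
  refine ⟨k, c, fun j => Ideal.Quotient.mk _ (z j), fun i => ?_, hc⟩
  have hyz : Ideal.Quotient.mk (Ideal.span {y}) y = 0 :=
    Ideal.Quotient.eq_zero_iff_mem.mpr (Ideal.mem_span_singleton_self y)
  have := congrArg (Ideal.Quotient.mk (Ideal.span {y})) (hz i)
  rw [map_sub, map_mul, hyz, mul_zero, sub_zero, hx'] at this
  rw [this, map_sum]
  refine Finset.sum_congr rfl fun j _ => ?_
  rw [Algebra.smul_def, Algebra.smul_def, map_mul]; rfl

/-- A sequence that is weakly regular on the closed fibre of the flat map `R → S ⧸ K` is weakly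
regular on `S ⧸ K` itself, and the quotient by it is again flat over `R`. -/
theorem isWeaklyRegular_and_flat_of_flat {R S : Type*} [CommRing R] [CommRing S] [Algebra R S]
    [IsNoetherianRing R] [IsLocalRing R] [IsNoetherianRing S] [IsLocalRing S]
    [IsLocalHom (algebraMap R S)] (ys : List S) (hys : ∀ y ∈ ys, y ∈ maximalIdeal S)
    (K : Ideal S) (hK : K ≤ maximalIdeal S) [Module.Flat R (S ⧸ K)]
    (h : IsWeaklyRegular (S ⧸ ((maximalIdeal R).map (algebraMap R S) ⊔ K)) ys) :
    IsWeaklyRegular (S ⧸ K) ys ∧ Module.Flat R (S ⧸ (K ⊔ Ideal.ofList ys)) := by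
  induction ys generalizing K with
  | nil =>
    refine ⟨.nil _ _, ?_⟩
    exact Module.Flat.of_linearEquiv
      (Ideal.quotientEquivAlgOfEq R (show K ⊔ Ideal.ofList [] = K by simp)).toLinearEquiv
  | cons y ys ih =>
    rw [isWeaklyRegular_quotient_cons_iff] at h ⊢
    have hyK : K ⊔ Ideal.span {y} ≤ maximalIdeal S :=
      sup_le hK ((Ideal.span_singleton_le_iff_mem _).mpr (hys y (by simp)))
    have : Nontrivial (S ⧸ K) := Ideal.Quotient.nontrivial_iff.mpr fun hK' => by
      rw [hK', top_le_iff] at hK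
      exact Ideal.IsPrime.ne_top inferInstance hK
    have : IsLocalRing (S ⧸ K) := .of_surjective' _ Ideal.Quotient.mk_surjective
    have hmk : IsLocalHom (Ideal.Quotient.mk K) := .of_surjective _ Ideal.Quotient.mk_surjective
    have : IsLocalHom (algebraMap R (S ⧸ K)) := by
      rw [IsScalarTower.algebraMap_eq R S (S ⧸ K)]
      exact RingHom.isLocalHom_comp _ _
    have hmem (I : Ideal R) (s : S) : Ideal.Quotient.mk K s ∈ I.map (algebraMap R (S ⧸ K)) ↔
        s ∈ I.map (algebraMap R S) ⊔ K := by
      rw [IsScalarTower.algebraMap_eq R S (S ⧸ K), ← Ideal.map_map, ← Ideal.mem_comap]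
      rw [show algebraMap S (S ⧸ K) = Ideal.Quotient.mk K from rfl]
      rw [Ideal.comap_map_of_surjective' _ Ideal.Quotient.mk_surjective, Ideal.mk_ker]
    have key : ∀ (I : Ideal R) (s : S ⧸ K), Ideal.Quotient.mk K y * s ∈
        I.map (algebraMap R (S ⧸ K)) → s ∈ I.map (algebraMap R (S ⧸ K)) := by
      intro I s hs
      refine mem_map_of_mul_mem_map_of_flat (fun s => ?_) I hs
      obtain ⟨s, rfl⟩ := Ideal.Quotient.mk_surjective s
      rw [← map_mul, hmem, hmem]
      exact h.1 s
    have hflat := flat_quotient_span_singleton key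
    have hflat' : Module.Flat R (S ⧸ (K ⊔ Ideal.span {y})) := by
      refine Module.Flat.of_linearEquiv (M := (S ⧸ K) ⧸ Ideal.span {Ideal.Quotient.mk K y}) ?_
      refine ((Ideal.quotientEquivAlgOfEq R ?_).trans
        (DoubleQuot.quotQuotEquivQuotSupₐ R K (Ideal.span {y}))).symm.toLinearEquiv
      rw [Ideal.map_span, Set.image_singleton]; rfl
    obtain ⟨h1, h2⟩ := ih (fun z hz => hys z (by simp [hz])) (K ⊔ Ideal.span {y}) hyK
      (by rw [← sup_assoc]; exact h.2)
    refine ⟨⟨fun s hs => ?_, h1⟩, ?_⟩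
    · have := key ⊥ (Ideal.Quotient.mk K s)
      rw [Ideal.map_bot, Ideal.mem_bot, Ideal.mem_bot, ← map_mul, Ideal.Quotient.eq_zero_iff_mem,
        Ideal.Quotient.eq_zero_iff_mem] at this
      exact this hs
    · rw [Ideal.ofList_cons, ← sup_assoc]
      exact h2

/-- Depth is additive along a flat local homomorphism `R → S` of Noetherian local rings; the closed
fibre `S ⧸ mS` is given as a quotient map `f : S → F` with kernel `mS`. A maximal sequence of `S` is
obtained by lifting a maximal sequence `ys` of `F` and continuing with the image of a maximal
sequence `rs` of `R`. It is maximal because `u t` is a nonzero socle element modulo it when `u` is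
one modulo `rs` and `t` lifts one modulo `ys`. -/
theorem HasGrade.add_of_flat {R S F : Type*} [CommRing R] [CommRing S] [CommRing F] [Algebra R S]
    [IsNoetherianRing R] [IsLocalRing R] [IsNoetherianRing S] [IsLocalRing S] [IsLocalRing F]
    [IsLocalHom (algebraMap R S)] [Module.Flat R S] (f : S →+* F) (hf : Function.Surjective f)
    (hker : RingHom.ker f = (maximalIdeal R).map (algebraMap R S)) {a b : ℕ}
    (ha : HasGrade (maximalIdeal R) a) (hb : HasGrade (maximalIdeal F) b) :
    HasGrade (maximalIdeal S) (a + b) := by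
  have : IsNoetherianRing F := isNoetherianRing_of_surjective S F f hf
  have hfl : IsLocalHom f := .of_surjective f hf
  obtain ⟨rs, hrs⟩ := ha.exists_maximal
  obtain ⟨zs, hzs⟩ := hb.exists_maximal
  have hla := ha.length_eq rs hrs
  have hlb := hb.length_eq zs hzs
  obtain ⟨ys, rfl⟩ := List.map_surjective_iff.mpr hf zs
  rw [isMaximalSequenceIn_maximalIdeal_iff] at hrs hzs
  obtain ⟨hrs, hrm, u, hu, hum⟩ := hrs
  obtain ⟨hzs, hzm, z, hz, hzmm⟩ := hzs
  obtain ⟨t, rfl⟩ := hf z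
  have hmf (s : S) : f s ∈ maximalIdeal F ↔ s ∈ maximalIdeal S := by simp
  have hym : ∀ y ∈ ys, y ∈ maximalIdeal S := fun y hy =>
    (hmf y).mp (hzm _ (List.mem_map_of_mem hy))
  rw [isWeaklyRegular_map_of_surjective_iff f hf] at hzs
  have : Module.Flat R (S ⧸ (⊥ : Ideal S)) :=
    Module.Flat.of_linearEquiv (AlgEquiv.quotientBot R S).toLinearEquiv
  have hzs' : IsWeaklyRegular (S ⧸ ((maximalIdeal R).map (algebraMap R S) ⊔ ⊥)) ys :=
    ((Submodule.quotEquivOfEq _ _ (by rw [hker, sup_bot_eq])).isWeaklyRegular_congr ys).mp hzs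
  obtain ⟨hreg, hflat⟩ := isWeaklyRegular_and_flat_of_flat (R := R) ys hym ⊥ bot_le hzs'
  rw [← hla, ← hlb, List.length_map]
  have hlen : rs.length + ys.length = (ys ++ rs.map (algebraMap R S)).length := by
    simp [add_comm]
  rw [hlen]
  have hmapt {s : S} : f s ∈ Ideal.ofList (ys.map f) ↔
      s ∈ Ideal.ofList ys ⊔ (maximalIdeal R).map (algebraMap R S) := by
    rw [← Ideal.map_ofList, ← Ideal.mem_comap, Ideal.comap_map_of_surjective' _ hf, hker]
  refine (isMaximalSequenceIn_maximalIdeal_iff.mpr ⟨?_, ?_, algebraMap R S u * t, ?_, ?_⟩).hasGrade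
  · rw [← isWeaklyRegular_quotient_bot_iff, isWeaklyRegular_quotient_append_iff]
    refine ⟨hreg, ?_⟩
    rw [isWeaklyRegular_map_algebraMap_iff, ← isWeaklyRegular_map_algebraMap_iff
      (S := S ⧸ (⊥ ⊔ Ideal.ofList ys))]
    exact hrs.of_flat
  · intro s hs
    rcases List.mem_append.mp hs with hs | hs
    · exact hym s hs
    · obtain ⟨r, hr, rfl⟩ := List.mem_map.mp hs
      exact map_maximalIdeal_le R S (Ideal.mem_map_of_mem _ (hrm r hr))
  · -- If `u t` vanished modulo `rs` in the flat `R`-algebra `S ⧸ (ys)`, then `t` would lie in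
    -- `((rs) : u) S = mS` modulo `ys`.
    intro hmem
    rw [Ideal.ofList_append, ← Ideal.map_ofList] at hmem
    rw [bot_sup_eq] at hflat
    have h1 : algebraMap R (S ⧸ Ideal.ofList ys) u * Ideal.Quotient.mk _ t ∈
        (Ideal.ofList rs).map (algebraMap R (S ⧸ Ideal.ofList ys)) := by
      rw [IsScalarTower.algebraMap_eq R S (S ⧸ _), ← Ideal.map_map]
      have := Ideal.mem_map_of_mem (Ideal.Quotient.mk (Ideal.ofList ys)) hmem
      rwa [Ideal.map_sup, Ideal.map_quotient_self, bot_sup_eq, map_mul] at this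
    have h2 := mem_map_of_algebraMap_mul_mem_map_of_flat _ _ u
      (fun c hc => mem_maximalIdeal_of_mul_mem hu hc) h1
    rw [IsScalarTower.algebraMap_eq R S (S ⧸ _), ← Ideal.map_map, ← Ideal.mem_comap,
      show algebraMap S (S ⧸ Ideal.ofList ys) = Ideal.Quotient.mk _ from rfl,
      Ideal.comap_map_of_surjective' _ Ideal.Quotient.mk_surjective, Ideal.mk_ker, sup_comm] at h2
    exact hz (hmapt.mpr h2)
  · intro r hr
    have h1 : r * t ∈ Ideal.ofList ys ⊔ (maximalIdeal R).map (algebraMap R S) := by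
      rw [← hmapt, map_mul]
      exact hzmm _ ((hmf r).mpr hr)
    obtain ⟨v, hv, w, hw, hvw⟩ := Submodule.mem_sup.mp h1
    have : r * (algebraMap R S u * t) = algebraMap R S u * v + algebraMap R S u * w := by
      rw [← mul_add, hvw]; ring
    rw [this, Ideal.ofList_append, ← Ideal.map_ofList]
    refine Submodule.add_mem_sup (Ideal.mul_mem_left _ _ hv) ?_
    have h3 : algebraMap R S u * w ∈ (Ideal.span {u} * maximalIdeal R).map (algebraMap R S) := by
      rw [Ideal.map_mul]
      exact Ideal.mul_mem_mul (Ideal.mem_map_of_mem _ (Ideal.mem_span_singleton_self u)) hw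
    refine Ideal.map_mono (Ideal.mul_le.mpr fun x hx r hr => ?_) h3
    obtain ⟨c, rfl⟩ := Ideal.mem_span_singleton'.mp hx
    have := Ideal.mul_mem_left _ c (hum r hr)
    convert this using 1
    ring

end

/-! ### Flat maps at a prime, and the Cohen-Macaulay property -/

section

open IsLocalRing RingTheory.Sequence

theorem ker_localRingHom_of_surjective {S T : Type*} [CommRing S] [CommRing T] (g : S →+* T)
    (hg : Function.Surjective g) (P : Ideal S) [P.IsPrime] (P' : Ideal T) [P'.IsPrime]
    (hP : P = P'.comap g) :
    RingHom.ker (Localization.localRingHom P P' g hP) =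
      (RingHom.ker g).map (algebraMap S (Localization.AtPrime P)) := by
  ext x
  obtain ⟨s, u, rfl⟩ := IsLocalization.exists_mk'_eq P.primeCompl x
  rw [RingHom.mem_ker, Localization.localRingHom_mk', IsLocalization.mk'_eq_zero_iff]
  constructor
  · rintro ⟨⟨v, hv⟩, hvs⟩
    obtain ⟨v, rfl⟩ := hg v
    have hv' : v ∈ P.primeCompl := fun h => hv (by rw [hP] at h; exact h)
    rw [IsLocalization.mk'_mem_map_algebraMap_iff P.primeCompl]
    exact ⟨v, hv', by simpa [RingHom.mem_ker] using hvs⟩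
  · rw [IsLocalization.mk'_mem_map_algebraMap_iff P.primeCompl]
    rintro ⟨v, hv, hvs⟩
    refine ⟨⟨g v, fun h => hv (by rw [hP]; exact h)⟩, by simpa [RingHom.mem_ker] using hvs⟩

/-- Additivity of depth for a flat ring homomorphism `f : R → S`, at a prime `P` of `S` over `p`;
the fibre ring `S ⧸ pS` is given as a quotient map `g : S → T` with kernel `pS`. -/
theorem hasGrade_localization_of_flat {R S T : Type*} [CommRing R] [CommRing S] [CommRing T]
    [IsNoetherianRing R] [IsNoetherianRing S] {f : R →+* S} (hf : f.Flat) (g : S →+* T)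
    (hg : Function.Surjective g) (p : Ideal R) [p.IsPrime] (P : Ideal S) [P.IsPrime]
    (P' : Ideal T) [P'.IsPrime] (hp : p = P.comap f) (hP : P = P'.comap g)
    (hker : RingHom.ker g = p.map f) {a b : ℕ}
    (ha : HasGrade (maximalIdeal (Localization.AtPrime p)) a)
    (hb : HasGrade (maximalIdeal (Localization.AtPrime P')) b) :
    HasGrade (maximalIdeal (Localization.AtPrime P)) (a + b) := by
  have hflat := hf.localRingHom P p hp
  have hlocal := Localization.isLocalHom_localRingHom p P f hp
  algebraize [Localization.localRingHom p P f hp]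
  have : IsLocalHom (algebraMap (Localization.AtPrime p) (Localization.AtPrime P)) := hlocal
  have hnoe := IsLocalization.isNoetherianRing p.primeCompl (Localization.AtPrime p) inferInstance
  have hnoe' := IsLocalization.isNoetherianRing P.primeCompl (Localization.AtPrime P) inferInstance
  refine HasGrade.add_of_flat (Localization.localRingHom P P' g hP)
    ((RingHom.surjectiveOnStalks_of_surjective hg).localRingHom_surjective _ _ hP) ?_ ha hb
  rw [ker_localRingHom_of_surjective g hg, hker, ← Localization.AtPrime.map_eq_maximalIdeal,
    Ideal.map_map, Ideal.map_map]
  congr 1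
  ext r
  exact (Localization.localRingHom_to_map p P f hp r).symm

theorem Ideal.eq_comap_map_of_ker_le {S T : Type*} [CommRing S] [CommRing T] (g : S →+* T)
    (hg : Function.Surjective g) {P : Ideal S} (h : RingHom.ker g ≤ P) : P = (P.map g).comap g := by
  rw [Ideal.comap_map_of_surjective' _ hg, sup_eq_left.mpr h]

theorem height_map_quotientMk_of_surjective {S T : Type*} [CommRing S] [CommRing T] (g : S →+* T)
    (hg : Function.Surjective g) (P : Ideal S) (P' : Ideal T) (hP : P = P'.comap g) {I : Ideal S}
    (hI : RingHom.ker g = I) : (P.map (Ideal.Quotient.mk I)).height = P'.height := by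
  let e : S ⧸ I ≃+* T :=
    (Ideal.quotEquivOfEq hI.symm).trans (RingHom.quotientKerEquivOfSurjective hg)
  rw [← e.height_comap P']
  congr 1
  have : P = (P'.comap e).comap (Ideal.Quotient.mk I) := by
    rw [hP]; rfl
  conv_lhs => rw [this]
  exact Ideal.map_comap_of_surjective _ Ideal.Quotient.mk_surjective _

theorem height_eq_add_of_flat {R S T : Type*} [CommRing R] [CommRing S] [CommRing T]
    [IsNoetherianRing R] [IsNoetherianRing S] {f : R →+* S} (hf : f.Flat) (g : S →+* T)
    (hg : Function.Surjective g) (p : Ideal R) [p.IsPrime] (P : Ideal S) [P.IsPrime]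
    (P' : Ideal T) [P'.IsPrime] (hp : p = P.comap f) (hP : P = P'.comap g)
    (hker : RingHom.ker g = p.map f) : P.height = p.height + P'.height := by
  algebraize [f]
  have : P.LiesOver p := ⟨hp⟩
  rw [Ideal.height_eq_height_add_of_liesOver_of_hasGoingDown p P]
  exact congrArg (p.height + ·) (height_map_quotientMk_of_surjective g hg P P' hP hker)

/-- A ring is *Cohen-Macaulay at* a prime `P` if the depth of its local ring at `P`, i.e. the grade
of the maximal ideal, exists and equals the height of `P`; both are required to be finite. -/
def Ideal.IsCohenMacaulayAt {R : Type*} [CommRing R] (P : Ideal R) [P.IsPrime] : Prop :=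
  ∃ n : ℕ, P.height = n ∧ HasGrade (maximalIdeal (Localization.AtPrime P)) n

/-- For a flat map, if the base is Cohen-Macaulay at `p` and the fibre over `p` is Cohen-Macaulay at
`P'`, then the total ring is Cohen-Macaulay at `P`: height and depth are both additive. -/
theorem Ideal.IsCohenMacaulayAt.of_flat {R S T : Type*} [CommRing R] [CommRing S] [CommRing T]
    [IsNoetherianRing R] [IsNoetherianRing S] {f : R →+* S} (hf : f.Flat) (g : S →+* T)
    (hg : Function.Surjective g) (p : Ideal R) [p.IsPrime] (P : Ideal S) [P.IsPrime]
    (P' : Ideal T) [P'.IsPrime] (hp : p = P.comap f) (hP : P = P'.comap g)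
    (hker : RingHom.ker g = p.map f) (h : p.IsCohenMacaulayAt) (h' : P'.IsCohenMacaulayAt) :
    P.IsCohenMacaulayAt := by
  obtain ⟨a, ha, ha'⟩ := h
  obtain ⟨b, hb, hb'⟩ := h'
  refine ⟨a + b, ?_, hasGrade_localization_of_flat hf g hg p P P' hp hP hker ha' hb'⟩
  rw [height_eq_add_of_flat hf g hg p P P' hp hP hker, ha, hb, Nat.cast_add]

theorem Ideal.IsCohenMacaulayAt.comap_of_isLocalization {R S : Type*} [CommRing R] [CommRing S]
    [Algebra R S] (M : Submonoid R) [IsLocalization M S] (P : Ideal S) [P.IsPrime]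
    (h : P.IsCohenMacaulayAt) : (P.comap (algebraMap R S)).IsCohenMacaulayAt := by
  obtain ⟨n, hn, hn'⟩ := h
  refine ⟨n, ?_, ?_⟩
  · rw [← hn]
    exact IsLocalization.height_under M P
  · have := IsLocalization.isLocalization_isLocalization_atPrime_isLocalization M
      (Localization.AtPrime P) P
    exact hn'.of_ringEquiv (IsLocalization.algEquiv (P.comap (algebraMap R S)).primeCompl
      (Localization.AtPrime P) (Localization.AtPrime (P.comap (algebraMap R S)))).toRingEquiv

theorem Ideal.IsCohenMacaulayAt.comap_ringEquiv {R S : Type*} [CommRing R] [CommRing S]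
    (e : R ≃+* S) (P : Ideal S) [P.IsPrime] (h : P.IsCohenMacaulayAt) :
    (P.comap (e : R →+* S)).IsCohenMacaulayAt := by
  algebraize [(e : R →+* S)]
  have : IsLocalization (⊥ : Submonoid R) S :=
    IsLocalization.of_le_isUnit_of_bijective (by
      rintro _ ⟨y, hy, rfl⟩
      rw [Submonoid.mem_bot.mp hy, map_one]
      exact one_mem _) e.bijective
  exact h.comap_of_isLocalization ⊥ P

/-- A Noetherian local ring whose maximal ideal is generated by one element `t` is
Cohen-Macaulay: either `t` is nilpotent and the dimension is zero, or `t` is a nonzerodivisor. -/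
theorem exists_height_eq_hasGrade_of_maximalIdeal_eq_span_singleton {R : Type*} [CommRing R]
    [IsNoetherianRing R] [IsLocalRing R] {t : R} (ht : maximalIdeal R = Ideal.span {t}) :
    ∃ n : ℕ, (maximalIdeal R).height = n ∧ HasGrade (maximalIdeal R) n := by
  by_cases hnil : IsNilpotent t
  · obtain ⟨n, hn⟩ := hnil
    refine ⟨0, ?_, ?_⟩
    · rw [Nat.cast_zero, Ideal.height_eq_zero_iff, minimalPrimes_eq_minimals]
      refine ⟨inferInstance, fun q hq _ => ?_⟩
      rw [ht, Ideal.span_singleton_le_iff_mem]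
      have hq' : q.IsPrime := hq
      exact hq'.mem_of_pow_mem n (by rw [hn]; exact q.zero_mem)
    · have hpow : maximalIdeal R ^ n ≤ ⊥ := by
        rw [ht, Ideal.span_singleton_pow, hn]; simp
      obtain ⟨a, ha, hma⟩ := exists_notMem_forall_mul_mem_of_maximalIdeal_pow_le bot_ne_top hpow
      exact (isMaximalSequenceIn_maximalIdeal_iff (rs := []).mpr
        ⟨.nil R R, by simp, a, by simpa using ha, by simpa using hma⟩).hasGrade
  · have htm : t ∈ maximalIdeal R := by rw [ht]; exact Ideal.mem_span_singleton_self t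
    have hreg : ∀ z, t * z = 0 → z = 0 := by
      intro z hz
      rw [← Ideal.mem_bot]
      refine mem_of_forall_mem_sup_maximalIdeal_pow fun n => ?_
      rw [bot_sup_eq]
      induction n with
      | zero => simp
      | succ n ih =>
        rw [ht, Ideal.span_singleton_pow, Ideal.mem_span_singleton'] at ih ⊢
        obtain ⟨u, rfl⟩ := ih
        by_cases hu : IsUnit u
        · refine absurd ⟨n + 1, ?_⟩ hnil
          rw [mul_left_comm, hu.mul_right_eq_zero] at hz
          rw [pow_succ', hz]
        · have : u ∈ maximalIdeal R := hu
          rw [ht, Ideal.mem_span_singleton'] at this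
          obtain ⟨v, rfl⟩ := this
          exact ⟨v, by ring⟩
    have hmax : IsMaximalSequenceIn (maximalIdeal R) [t] := by
      rw [isMaximalSequenceIn_maximalIdeal_iff]
      refine ⟨?_, by simpa using htm, 1, ?_, ?_⟩
      · rw [isWeaklyRegular_singleton_iff, isSMulRegular_iff_right_eq_zero_of_smul]
        exact hreg
      · rw [Ideal.ofList_singleton, ← ht, ← Ideal.ne_top_iff_one]
        exact Ideal.IsPrime.ne_top inferInstance
      · rw [Ideal.ofList_singleton, ← ht]; simp
    refine ⟨1, le_antisymm ?_ ?_, hmax.hasGrade⟩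
    · have : (maximalIdeal R).IsPrincipal := ⟨t, ht⟩
      refine Ideal.height_le_one_of_isPrincipal_of_mem_minimalPrimes (maximalIdeal R) _ ?_
      rw [Ideal.minimalPrimes_eq_subsingleton_self]; rfl
    · have := IsRegular.length_le_ringKrullDim hmax.isRegular
      rw [← maximalIdeal_height_eq_ringKrullDim] at this
      exact_mod_cast this

theorem Ideal.isCohenMacaulayAt_of_maximalIdeal_eq_span_singleton {R : Type*} [CommRing R]
    [IsNoetherianRing R] (P : Ideal R) [P.IsPrime] {t : Localization.AtPrime P}
    (ht : maximalIdeal (Localization.AtPrime P) = Ideal.span {t}) : P.IsCohenMacaulayAt := by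
  have := IsLocalization.isNoetherianRing P.primeCompl (Localization.AtPrime P) inferInstance
  obtain ⟨n, hn, hn'⟩ := exists_height_eq_hasGrade_of_maximalIdeal_eq_span_singleton ht
  refine ⟨n, ?_, hn'⟩
  rw [← hn, ← IsLocalization.height_under P.primeCompl (maximalIdeal (Localization.AtPrime P)),
    IsLocalization.AtPrime.under_maximalIdeal _ P]

end

/-! ### Tensor products of fields -/

section

open IsLocalRing Polynomial TensorProduct

/-- Let `f : R → S` be flat and suppose that `S` is, up to units, generated over `R` by one element
`x` (that is, `S` is a localization of a quotient of `R[X]`). Then the Cohen-Macaulay property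
passes from the primes of `R` to those of `S`: the local rings of the fibres are local rings of
localized quotients of polynomial rings in one variable over a field, so their maximal ideals are
principal. -/
theorem isCohenMacaulayAt_of_flat_of_forall_exists_eval₂ {R S : Type*} [CommRing R] [CommRing S]
    [IsNoetherianRing R] [IsNoetherianRing S] {f : R →+* S} (hf : f.Flat) (x : S)
    (hx : ∀ s : S, ∃ g h : R[X], IsUnit (g.eval₂ f x) ∧ g.eval₂ f x * s = h.eval₂ f x)
    (hR : ∀ (p : Ideal R) [p.IsPrime], p.IsCohenMacaulayAt) (P : Ideal S) [P.IsPrime] :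
    P.IsCohenMacaulayAt := by
  set p := P.comap f with hp
  have hle : p.map f ≤ P := Ideal.map_comap_le
  let mk := Ideal.Quotient.mk (p.map f)
  let P' := P.map mk
  have hker : RingHom.ker mk ≤ P := by rwa [Ideal.mk_ker]
  have : P'.IsPrime := Ideal.map_isPrime_of_surjective Ideal.Quotient.mk_surjective hker
  have hP : P = P'.comap mk := Ideal.eq_comap_map_of_ker_le mk Ideal.Quotient.mk_surjective hker
  refine Ideal.IsCohenMacaulayAt.of_flat hf mk Ideal.Quotient.mk_surjective p P P' hp hP
    (Ideal.mk_ker) (hR p) ?_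
  let D := Localization.AtPrime P'
  let ι : S →+* D := (algebraMap _ D).comp mk
  have hι (s : S) : IsUnit (ι s) ↔ s ∉ P := by
    rw [RingHom.comp_apply, IsLocalization.AtPrime.isUnit_to_map_iff D P', hP]
    rfl
  have hφ₁ : p ≤ RingHom.ker (ι.comp f) := fun r hr => by
    have : mk (f r) = 0 := Ideal.Quotient.eq_zero_iff_mem.mpr (Ideal.mem_map_of_mem f hr)
    simp [RingHom.mem_ker, ι, this]
  have hφ₂ : p.primeCompl ≤ (IsUnit.submonoid D).comap (ι.comp f) := fun r hr => (hι _).mpr hr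
  let φ : p.ResidueField →+* D := Ideal.ResidueField.lift p (ι.comp f) hφ₁ hφ₂
  let ψ : p.ResidueField[X] →+* D := eval₂RingHom φ (ι x)
  have hψ (h : R[X]) : ψ (h.map (algebraMap R p.ResidueField)) = ι (h.eval₂ f x) := by
    rw [coe_eval₂RingHom, eval₂_map, hom_eval₂]
    congr 1
    exact RingHom.ext fun r => Ideal.ResidueField.lift_algebraMap p (ι.comp f) hφ₁ hφ₂ r
  obtain ⟨q, hq⟩ := (IsPrincipalIdealRing.principal ((maximalIdeal D).comap ψ)).principal
  refine Ideal.isCohenMacaulayAt_of_maximalIdeal_eq_span_singleton P' (t := ψ q)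
    (le_antisymm (fun d hd => ?_) ?_)
  · obtain ⟨⟨t, u⟩, htu⟩ := IsLocalization.surj P'.primeCompl d
    obtain ⟨s, rfl⟩ := Ideal.Quotient.mk_surjective t
    have hu : IsUnit (algebraMap _ D (u : S ⧸ p.map f)) := IsLocalization.map_units D u
    obtain ⟨g, h, hg, hgh⟩ := hx s
    have hg' : IsUnit (ι (g.eval₂ f x)) := hg.map ι
    have heq : d * (algebraMap _ D (u : S ⧸ p.map f) * ι (g.eval₂ f x)) =
        ψ (h.map (algebraMap R p.ResidueField)) := by
      rw [hψ, ← hgh, map_mul, mul_comm (ι _), ← mul_assoc]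
      congr 1
    have hmem : h.map (algebraMap R p.ResidueField) ∈ (maximalIdeal D).comap ψ := by
      rw [Ideal.mem_comap, ← heq]
      exact Ideal.mul_mem_right _ _ hd
    rw [hq] at hmem
    obtain ⟨c, hc⟩ := Ideal.mem_span_singleton'.mp hmem
    rw [← Ideal.mul_unit_mem_iff_mem _ (hu.mul hg'), heq, ← hc, map_mul]
    exact Ideal.mul_mem_left _ _ (Ideal.mem_span_singleton_self _)
  · rw [Ideal.span_singleton_le_iff_mem, ← Ideal.mem_comap, hq]
    exact Ideal.mem_span_singleton_self q

theorem isCohenMacaulayAt_bot (R : Type*) [CommRing R] [IsDomain R] [IsNoetherianRing R] :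
    (⊥ : Ideal R).IsCohenMacaulayAt := by
  refine Ideal.isCohenMacaulayAt_of_maximalIdeal_eq_span_singleton ⊥ (t := 0) ?_
  rw [← Localization.AtPrime.map_eq_maximalIdeal, Ideal.map_bot, Ideal.span_singleton_zero]

/-- If `K' = K(x)`, then `K' ⊗ L` is, up to units, generated by `x ⊗ 1` over `K ⊗ L`. The hypothesis
`hx` expresses `K' = K(x)`; a vanishing denominator `s` gives `y = r / 0 = 0`, which is harmless. -/
theorem exists_isUnit_eval₂_mul_eq_eval₂ {k K K' L : Type*} [Field k] [Field K] [Field K']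
    [CommRing L] [Algebra k K] [Algebra k K'] [Algebra K K'] [IsScalarTower k K K'] [Algebra k L]
    (x : K') (hx : ∀ y : K', ∃ r s : K[X], y = aeval x r / aeval x s)
    (f : K ⊗[k] L →+* K' ⊗[k] L)
    (hf : f = Algebra.TensorProduct.map (IsScalarTower.toAlgHom k K K') (AlgHom.id k L))
    (s : K' ⊗[k] L) :
    ∃ g h : (K ⊗[k] L)[X], IsUnit (g.eval₂ f (x ⊗ₜ 1)) ∧
      g.eval₂ f (x ⊗ₜ 1) * s = h.eval₂ f (x ⊗ₜ 1) := by
  have hev (r : K[X]) : (r.map (Algebra.TensorProduct.includeLeft :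
      K →ₐ[k] K ⊗[k] L).toRingHom).eval₂ f (x ⊗ₜ 1) = (aeval x r) ⊗ₜ[k] (1 : L) := by
    rw [eval₂_map, aeval_def]
    refine Eq.trans ?_ (hom_eval₂ r (algebraMap K K')
      (Algebra.TensorProduct.includeLeft : K' →ₐ[k] K' ⊗[k] L).toRingHom x).symm
    congr 1
    ext a
    simp [hf]
  induction s using TensorProduct.induction_on with
  | zero => exact ⟨1, 0, by simp, by simp⟩
  | add s₁ s₂ h₁ h₂ =>
    obtain ⟨g₁, h₁, hu₁, e₁⟩ := h₁
    obtain ⟨g₂, h₂, hu₂, e₂⟩ := h₂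
    refine ⟨g₁ * g₂, h₁ * g₂ + g₁ * h₂, ?_, ?_⟩
    · rw [eval₂_mul]; exact hu₁.mul hu₂
    · simp only [eval₂_mul, eval₂_add, ← e₁, ← e₂]; ring
  | tmul y l =>
    obtain ⟨r, s, rfl⟩ := hx y
    by_cases hs : aeval x s = 0
    · exact ⟨1, 0, by simp, by simp [hs]⟩
    · refine ⟨s.map (Algebra.TensorProduct.includeLeft : K →ₐ[k] K ⊗[k] L).toRingHom,
        r.map (Algebra.TensorProduct.includeLeft : K →ₐ[k] K ⊗[k] L).toRingHom *
          C (1 ⊗ₜ l), ?_, ?_⟩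
      · rw [hev]
        exact (IsUnit.mk0 _ hs).map (Algebra.TensorProduct.includeLeft : K' →ₐ[k] K' ⊗[k] L)
      · rw [eval₂_mul, hev, hev, eval₂_C, hf]
        simp [mul_div_cancel₀ _ hs]

theorem flat_tensorProduct_map_id {k K K' L : Type*} [Field k] [Field K] [Field K']
    [CommRing L] [Algebra k K] [Algebra k K'] [Algebra k L] (f : K →ₐ[k] K') :
    (Algebra.TensorProduct.map f (AlgHom.id k L)).toRingHom.Flat :=
  RingHom.Flat.tensorProductMap (RingHom.Flat.of_isField (Field.toIsField K) _) (RingHom.Flat.id L)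

theorem isNoetherianRing_tensorProduct_of_essFiniteType (k K L : Type*) [Field k] [Field K]
    [CommRing L] [Algebra k K] [Algebra k L] [Algebra.EssFiniteType k K] [IsNoetherianRing L] :
    IsNoetherianRing (K ⊗[k] L) := by
  have : IsNoetherianRing (L ⊗[k] K) := Algebra.EssFiniteType.isNoetherianRing L _
  exact isNoetherianRing_of_ringEquiv _ (Algebra.TensorProduct.comm k L K).toRingEquiv

theorem isCohenMacaulayAt_tensorProduct_of_simple {k K K' L : Type*} [Field k] [Field K] [Field K']
    [CommRing L] [Algebra k K] [Algebra k K'] [Algebra K K'] [IsScalarTower k K K'] [Algebra k L]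
    [IsNoetherianRing (K ⊗[k] L)] [IsNoetherianRing (K' ⊗[k] L)]
    (x : K') (hx : ∀ y : K', ∃ r s : K[X], y = aeval x r / aeval x s)
    (hK : ∀ (p : Ideal (K ⊗[k] L)) [p.IsPrime], p.IsCohenMacaulayAt)
    (P : Ideal (K' ⊗[k] L)) [P.IsPrime] : P.IsCohenMacaulayAt :=
  isCohenMacaulayAt_of_flat_of_forall_exists_eval₂
    (flat_tensorProduct_map_id (IsScalarTower.toAlgHom k K K')) (x ⊗ₜ 1)
    (exists_isUnit_eval₂_mul_eq_eval₂ x hx _ rfl) hK P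

/-- For a finitely generated extension `K` of `k` all primes of `K ⊗ L` are Cohen-Macaulay: adjoin
one element at a time. -/
theorem isCohenMacaulayAt_tensorProduct_of_fg {k E L : Type*} [Field k] [Field E] [Field L]
    [Algebra k E] [Algebra k L] (K : IntermediateField k E) (hK : K.FG)
    (P : Ideal (K ⊗[k] L)) [P.IsPrime] : Ideal.IsCohenMacaulayAt (R := K ⊗[k] L) P := by
  suffices h : Algebra.EssFiniteType k K ∧
    ∀ (P : Ideal (K ⊗[k] L)) [P.IsPrime], Ideal.IsCohenMacaulayAt (R := K ⊗[k] L) P from h.2 P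
  refine IntermediateField.induction_on_adjoin_fg (fun K => Algebra.EssFiniteType k K ∧
    ∀ (P : Ideal (K ⊗[k] L)) [P.IsPrime], Ideal.IsCohenMacaulayAt (R := K ⊗[k] L) P) ?_ ?_ K hK
  · refine ⟨IntermediateField.essFiniteType_iff.mpr IntermediateField.fg_bot, fun P _ => ?_⟩
    let e : (⊥ : IntermediateField k E) ⊗[k] L ≃ₐ[k] L :=
      (Algebra.TensorProduct.congr (IntermediateField.botEquiv k E) AlgEquiv.refl).trans
        (Algebra.TensorProduct.lid k L)
    have hP : P = (⊥ : Ideal L).comap (e.toRingEquiv : _ →+* L) := by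
      rw [← Ideal.eq_bot_of_prime (P.comap (e.symm.toRingEquiv : L →+* _)), Ideal.comap_comap]
      ext s
      simp [Ideal.mem_comap]
    have h := (isCohenMacaulayAt_bot L).comap_ringEquiv
      (R := (⊥ : IntermediateField k E) ⊗[k] L) e.toRingEquiv
    subst hP
    exact h
  · intro K x ⟨hK, hCM⟩
    let K' := IntermediateField.adjoin K {x}
    have : Algebra.EssFiniteType K K' := IntermediateField.essFiniteType_iff.mpr
      (IntermediateField.fg_adjoin_of_finite (Set.finite_singleton x))
    have hK' : Algebra.EssFiniteType k K' := Algebra.EssFiniteType.comp k K K'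
    refine ⟨hK', fun P hP => ?_⟩
    have := isNoetherianRing_tensorProduct_of_essFiniteType k K L
    have := isNoetherianRing_tensorProduct_of_essFiniteType k K' L
    have key := isCohenMacaulayAt_tensorProduct_of_simple (k := k) (K := K) (K' := K') (L := L)
      ⟨x, IntermediateField.mem_adjoin_simple_self K x⟩ (fun y => by
        obtain ⟨r, s, h⟩ := (IntermediateField.mem_adjoin_simple_iff K _).mp y.2
        have hc (r : K[X]) : ((aeval (⟨x, IntermediateField.mem_adjoin_simple_self K x⟩ : K') r :
            K') : E) = aeval x r :=
          (aeval_algebraMap_apply E (⟨x, IntermediateField.mem_adjoin_simple_self K x⟩ : K') r).symm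
        refine ⟨r, s, Subtype.ext ?_⟩
        rw [h, ← hc, ← hc]; rfl) hCM
    exact @key P hP

/-- If `P` is generated by elements coming from `K₀ ⊗ L`, then it is extended from its contraction,
the fibre of `K₀ ⊗ L → K ⊗ L` over the contraction is the domain `(K ⊗ L) ⧸ P`, and the
Cohen-Macaulay property is inherited. -/
theorem isCohenMacaulayAt_tensorProduct_of_span_image {k K₀ K L : Type*} [Field k] [Field K₀]
    [Field K] [CommRing L] [Algebra k K₀] [Algebra k K] [Algebra k L]
    [IsNoetherianRing (K₀ ⊗[k] L)] [IsNoetherianRing (K ⊗[k] L)] (φ : K₀ →ₐ[k] K)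
    (hK₀ : ∀ (p : Ideal (K₀ ⊗[k] L)) [p.IsPrime], p.IsCohenMacaulayAt)
    (P : Ideal (K ⊗[k] L)) [P.IsPrime] (G : Set (K ⊗[k] L)) (hG : Ideal.span G = P)
    (hφ : ∀ g ∈ G, ∃ y, Algebra.TensorProduct.map φ (AlgHom.id k L) y = g) :
    P.IsCohenMacaulayAt := by
  set f : K₀ ⊗[k] L →+* K ⊗[k] L := (Algebra.TensorProduct.map φ (AlgHom.id k L)).toRingHom
  have hmap : (P.comap f).map f = P := by
    refine le_antisymm Ideal.map_comap_le ?_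
    conv_lhs => rw [← hG]
    refine Ideal.span_le.mpr fun g hg => ?_
    obtain ⟨y, rfl⟩ := hφ g hg
    refine Ideal.mem_map_of_mem f ?_
    rw [Ideal.mem_comap, ← hG]
    exact Ideal.subset_span hg
  refine Ideal.IsCohenMacaulayAt.of_flat (flat_tensorProduct_map_id φ) (Ideal.Quotient.mk P)
    Ideal.Quotient.mk_surjective (P.comap f) P ⊥ rfl ?_ ?_ (hK₀ _) (isCohenMacaulayAt_bot _)
  · exact (Ideal.mk_ker (I := P)).symm
  · rw [Ideal.mk_ker]; exact hmap.symm

/-- If `K`, `L` are extension fields of `k` with `K ⊗ L` Noetherian, then all primes `P` of `K ⊗ L`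
are Cohen-Macaulay: `P` is generated by finitely many elements, so it is extended from `K₀ ⊗ L` with
`K₀ ⊆ K` finitely generated. -/
theorem isCohenMacaulayAt_tensorProduct {k K L : Type*} [Field k] [Field K] [Field L]
    [Algebra k K] [Algebra k L] [IsNoetherianRing (K ⊗[k] L)]
    (P : Ideal (K ⊗[k] L)) [P.IsPrime] : P.IsCohenMacaulayAt := by
  obtain ⟨G, hG⟩ := IsNoetherian.noetherian P
  obtain ⟨M, hM, hGM⟩ := TensorProduct.exists_finite_submodule_left_of_setFinite
    (G : Set (K ⊗[k] L)) G.finite_toSet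
  obtain ⟨t, ht⟩ := Module.Finite.iff_fg.mp hM
  let K₀ := IntermediateField.adjoin k (t : Set K)
  have hMK : M ≤ Subalgebra.toSubmodule K₀.toSubalgebra := by
    rw [← ht, Submodule.span_le]
    exact IntermediateField.subset_adjoin k _
  have hfg : K₀.FG := IntermediateField.fg_adjoin_of_finite t.finite_toSet
  have := IntermediateField.essFiniteType_iff.mpr hfg
  have := isNoetherianRing_tensorProduct_of_essFiniteType k K₀ L
  have hrange (x : M ⊗[k] L) :
      ∃ y, Algebra.TensorProduct.map K₀.val (AlgHom.id k L) y = M.subtype.rTensor L x := by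
    refine ⟨(Submodule.inclusion hMK).rTensor L x, ?_⟩
    induction x using TensorProduct.induction_on with
    | zero => simp
    | add x y hx hy => rw [map_add, map_add, map_add, hx, hy]
    | tmul m l => rfl
  refine isCohenMacaulayAt_tensorProduct_of_span_image K₀.val
    (fun p _ => isCohenMacaulayAt_tensorProduct_of_fg K₀ hfg p) P G hG fun g hg => ?_
  obtain ⟨x, hx⟩ := hGM hg
  rw [← hx]
  exact hrange x

end

/-! ### Tensor products of algebras over a field -/

section

open IsLocalRing TensorProduct

theorem Ideal.isCohenMacaulayAt_of_isLocalization {R S : Type*} [CommRing R] [CommRing S]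
    [Algebra R S] (M : Submonoid R) [IsLocalization M S] (P : Ideal R) [hP : P.IsPrime]
    (hM : Disjoint (M : Set R) P)
    (h : ∀ (Q : Ideal S) [Q.IsPrime], Q.comap (algebraMap R S) = P → Q.IsCohenMacaulayAt) :
    P.IsCohenMacaulayAt := by
  have hQ := IsLocalization.isPrime_of_isPrime_disjoint M S P hP hM
  have hQP : (P.map (algebraMap R S)).comap (algebraMap R S) = P :=
    IsLocalization.under_map_of_isPrime_disjoint M S hP hM
  have := (h _ hQP).comap_of_isLocalization M (P.map (algebraMap R S))
  simpa only [hQP] using this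

/-- Let `A`, `B` be domains over `k` with fraction fields `K`, `L`. A prime of `A ⊗ B` meeting `A`
and `B` only in `0` survives in the localization `K ⊗ L` of `A ⊗ B`, hence is Cohen-Macaulay. -/
theorem isCohenMacaulayAt_tensorProduct_of_comap_eq_bot {k A B : Type*} (K L : Type*) [Field k]
    [CommRing A] [CommRing B] [IsDomain A] [IsDomain B] [Algebra k A] [Algebra k B]
    [Field K] [Field L] [Algebra k K] [Algebra k L] [Algebra A K] [Algebra B L]
    [IsScalarTower k A K] [IsScalarTower k B L] [IsFractionRing A K] [IsFractionRing B L]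
    [IsNoetherianRing (A ⊗[k] B)]
    (P : Ideal (A ⊗[k] B)) [P.IsPrime]
    (hA : P.comap (Algebra.TensorProduct.includeLeft : A →ₐ[k] A ⊗[k] B) = ⊥)
    (hB : P.comap (Algebra.TensorProduct.includeRight : B →ₐ[k] A ⊗[k] B) = ⊥) :
    P.IsCohenMacaulayAt := by
  let φ : A ⊗[k] B →ₐ[k] K ⊗[k] B :=
    Algebra.TensorProduct.map (IsScalarTower.toAlgHom k A K) (AlgHom.id k B)
  let ψ : K ⊗[k] B →ₐ[k] K ⊗[k] L :=
    Algebra.TensorProduct.map (AlgHom.id k K) (IsScalarTower.toAlgHom k B L)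
  let : Algebra (A ⊗[k] B) (K ⊗[k] B) := φ.toRingHom.toAlgebra
  let : Algebra (K ⊗[k] B) (K ⊗[k] L) := ψ.toRingHom.toAlgebra
  have : IsScalarTower A (A ⊗[k] B) (K ⊗[k] B) := .of_algebraMap_eq fun a => by
    simp [RingHom.algebraMap_toAlgebra, φ]
  have : IsScalarTower K (K ⊗[k] B) (K ⊗[k] L) := .of_algebraMap_eq fun a => by
    simp [RingHom.algebraMap_toAlgebra, ψ]
  have loc₁ : IsLocalization (Algebra.algebraMapSubmonoid (A ⊗[k] B) (nonZeroDivisors A))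
      (K ⊗[k] B) := IsLocalization.tensorProduct_tensorProduct k B (nonZeroDivisors A) K (by
        ext b; simp [RingHom.algebraMap_toAlgebra, φ])
  have loc₂ : IsLocalization ((nonZeroDivisors B).map
      (Algebra.TensorProduct.includeRight (R := k) (A := K))) (K ⊗[k] L) :=
    IsLocalization.tensorProduct_tensorProduct_right k K (nonZeroDivisors B) L (by
      ext b; simp [RingHom.algebraMap_toAlgebra, ψ])
  have : IsNoetherianRing (K ⊗[k] B) := IsLocalization.isNoetherianRing
    (Algebra.algebraMapSubmonoid (A ⊗[k] B) (nonZeroDivisors A)) _ inferInstance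
  have : IsNoetherianRing (K ⊗[k] L) := IsLocalization.isNoetherianRing ((nonZeroDivisors B).map
      (Algebra.TensorProduct.includeRight (R := k) (A := K))) _ inferInstance
  refine Ideal.isCohenMacaulayAt_of_isLocalization (S := K ⊗[k] B)
    (Algebra.algebraMapSubmonoid (A ⊗[k] B) (nonZeroDivisors A)) P ?_ fun Q _ hQP => ?_
  · rw [Set.disjoint_left]
    rintro _ ⟨a, ha, rfl⟩ h
    have : a ∈ P.comap (Algebra.TensorProduct.includeLeft : A →ₐ[k] A ⊗[k] B) := h
    rw [hA, Ideal.mem_bot] at this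
    exact nonZeroDivisors.ne_zero ha this
  · refine Ideal.isCohenMacaulayAt_of_isLocalization (S := K ⊗[k] L)
      ((nonZeroDivisors B).map (Algebra.TensorProduct.includeRight (R := k) (A := K))) Q ?_
      fun Q' _ _ => isCohenMacaulayAt_tensorProduct Q'
    rw [Set.disjoint_left]
    rintro _ ⟨b, hb, rfl⟩ h
    have : b ∈ P.comap (Algebra.TensorProduct.includeRight : B →ₐ[k] A ⊗[k] B) := by
      rw [← hQP, Ideal.mem_comap, Ideal.mem_comap]
      have : algebraMap (A ⊗[k] B) (K ⊗[k] B)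
        ((Algebra.TensorProduct.includeRight : B →ₐ[k] A ⊗[k] B) b) =
        (Algebra.TensorProduct.includeRight : B →ₐ[k] K ⊗[k] B) b := by
          simp [RingHom.algebraMap_toAlgebra, φ]
      rw [this]
      exact h
    rw [hB, Ideal.mem_bot] at this
    exact nonZeroDivisors.ne_zero hb this

/-- Noetherianity descends along faithfully flat maps, because ideals are contracted from their
extensions. -/
theorem isNoetherianRing_of_faithfullyFlat (R S : Type*) [CommRing R] [CommRing S] [Algebra R S]
    [Module.FaithfullyFlat R S] [IsNoetherianRing S] : IsNoetherianRing R := by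
  rw [isNoetherianRing_iff, isNoetherian_iff']
  refine StrictMono.wellFoundedGT (f := fun I : Ideal R => I.map (algebraMap R S)) ?_
  refine (Monotone.strictMono_of_injective (fun I J h => Ideal.map_mono h) fun I J h => ?_)
  have := congrArg (Ideal.comap (algebraMap R S)) h
  simpa only [Ideal.comap_map_eq_self_of_faithfullyFlat] using this

end

open IsLocalRing TensorProduct

theorem proposition2p3 {k A B : Type*} [Field k] [CommRing A] [Algebra k A]
    [CommRing B] [Algebra k B] [IsNoetherianRing (TensorProduct k A B)]
    (P : Ideal (TensorProduct k A B)) [P.IsPrime]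
    (p : Ideal A) [p.IsPrime]
    (hp : p = P.comap (Algebra.TensorProduct.includeLeft : A →ₐ[k] TensorProduct k A B))
    (q : Ideal B) [q.IsPrime]
    (hq : q = P.comap (Algebra.TensorProduct.includeRight : B →ₐ[k] TensorProduct k A B))
    (J : Ideal (TensorProduct k A B))
    (hJ : J = p.map (Algebra.TensorProduct.includeLeft : A →ₐ[k] TensorProduct k A B) ⊔
      q.map (Algebra.TensorProduct.includeRight : B →ₐ[k] TensorProduct k A B)) :
    P.height = p.height + q.height + (P.map (Ideal.Quotient.mk J)).height ∧
    ∃ g g₁ g₂ : ℕ,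
      HasGrade (P.map (algebraMap (TensorProduct k A B) (Localization.AtPrime P))) g ∧
      HasGrade (p.map (algebraMap A (Localization.AtPrime p))) g₁ ∧
      HasGrade (q.map (algebraMap B (Localization.AtPrime q))) g₂ ∧
      (g : ℕ∞) = g₁ + g₂ + (P.map (Ideal.Quotient.mk J)).height := by
  have : Nontrivial A := nontrivial_of_ne 1 0 fun h =>
    ‹p.IsPrime›.one_notMem (h ▸ p.zero_mem)
  have : Nontrivial B := nontrivial_of_ne 1 0 fun h =>
    ‹q.IsPrime›.one_notMem (h ▸ q.zero_mem)
  have : IsNoetherianRing A := isNoetherianRing_of_faithfullyFlat A (A ⊗[k] B)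
  have : IsNoetherianRing (B ⊗[k] A) :=
    isNoetherianRing_of_ringEquiv _ (Algebra.TensorProduct.comm k A B).toRingEquiv
  have : IsNoetherianRing B := isNoetherianRing_of_faithfullyFlat B (B ⊗[k] A)
  let f₁ : A →+* A ⊗[k] B := (Algebra.TensorProduct.includeLeft : A →ₐ[k] A ⊗[k] B).toRingHom
  let f₂ : B →+* (A ⧸ p) ⊗[k] B :=
    (Algebra.TensorProduct.includeRight : B →ₐ[k] (A ⧸ p) ⊗[k] B).toRingHom
  let g₁ : A ⊗[k] B →ₐ[k] (A ⧸ p) ⊗[k] B :=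
    Algebra.TensorProduct.map (Ideal.Quotient.mkₐ k p) (AlgHom.id k B)
  let g₂ : (A ⧸ p) ⊗[k] B →ₐ[k] (A ⧸ p) ⊗[k] (B ⧸ q) :=
    Algebra.TensorProduct.map (AlgHom.id k (A ⧸ p)) (Ideal.Quotient.mkₐ k q)
  have hf₁ : f₁.Flat := 
    (RingHom.flat_algebraMap_iff (R := A) (S := A ⊗[k] B)).mpr inferInstance
  have hf₂ : f₂.Flat := by
    have h : (algebraMap B (B ⊗[k] (A ⧸ p))).Flat := RingHom.flat_algebraMap_iff.mpr inferInstance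
    exact h.comp (.of_bijective (Algebra.TensorProduct.comm k B (A ⧸ p)).bijective)
  have hkp : RingHom.ker (Ideal.Quotient.mkₐ k p) = p := Ideal.Quotient.mkₐ_ker k p
  have hkq : RingHom.ker (Ideal.Quotient.mkₐ k q) = q := Ideal.Quotient.mkₐ_ker k q
  have hg₁ : Function.Surjective g₁ := TensorProduct.map_surjective
    (Ideal.Quotient.mkₐ_surjective k p) Function.surjective_id
  have hg₂ : Function.Surjective g₂ := TensorProduct.map_surjective
    Function.surjective_id (Ideal.Quotient.mkₐ_surjective k q)
  have hker₁ : RingHom.ker g₁.toRingHom = p.map f₁ := by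
    have h := Algebra.TensorProduct.rTensor_ker (R := k) (S := k) (C := B) (Ideal.Quotient.mkₐ k p)
      (Ideal.Quotient.mkₐ_surjective k p)
    rwa [hkp] at h
  have hker₂ : RingHom.ker g₂.toRingHom = q.map f₂ := by
    have h := Algebra.TensorProduct.lTensor_ker (R := k) (A := A ⧸ p) (Ideal.Quotient.mkₐ k q)
      (Ideal.Quotient.mkₐ_surjective k q)
    rwa [hkq] at h
  have : IsNoetherianRing ((A ⧸ p) ⊗[k] B) := isNoetherianRing_of_surjective _ _ g₁.toRingHom hg₁
  have : IsNoetherianRing ((A ⧸ p) ⊗[k] (B ⧸ q)) :=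
    isNoetherianRing_of_surjective _ _ g₂.toRingHom hg₂
  -- the image `P₁` of `P` in `A/p ⊗ B`
  have hle₁ : RingHom.ker g₁.toRingHom ≤ P := by
    rw [hker₁, hp]; exact Ideal.map_comap_le
  let P₁ := P.map g₁.toRingHom
  have hP₁ : P₁.IsPrime := Ideal.map_isPrime_of_surjective hg₁ hle₁
  have hPP₁ : P = P₁.comap g₁.toRingHom :=
    Ideal.eq_comap_map_of_ker_le g₁.toRingHom hg₁ hle₁
  have hq₁ : q = P₁.comap f₂ := by
    rw [hq]
    conv_lhs => rw [hPP₁]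
    ext b
    simp [Ideal.mem_comap, f₂, g₁]
  -- the image `P₂` of `P` in `A/p ⊗ B/q`
  have hle₂ : RingHom.ker g₂.toRingHom ≤ P₁ := by
    rw [hker₂, hq₁]; exact Ideal.map_comap_le
  let P₂ := P₁.map g₂.toRingHom
  have hP₂ : P₂.IsPrime := Ideal.map_isPrime_of_surjective hg₂ hle₂
  have hPP₂ : P₁ = P₂.comap g₂.toRingHom :=
    Ideal.eq_comap_map_of_ker_le g₂.toRingHom hg₂ hle₂
  have hJ₂ : (P.map (Ideal.Quotient.mk J)).height = P₂.height := by
    refine height_map_quotientMk_of_surjective (g₂.toRingHom.comp g₁.toRingHom) (hg₂.comp hg₁) P P₂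
      (by rw [← Ideal.comap_comap, ← hPP₂, ← hPP₁]) ?_
    have h := Algebra.TensorProduct.map_ker (Ideal.Quotient.mkₐ k p) (Ideal.Quotient.mkₐ k q)
      (Ideal.Quotient.mkₐ_surjective k p) (Ideal.Quotient.mkₐ_surjective k q)
    rw [hkp, hkq, ← hJ] at h
    rw [← h]
    have hcomp : g₂.comp g₁ = Algebra.TensorProduct.map (Ideal.Quotient.mkₐ k p)
        (Ideal.Quotient.mkₐ k q) := by ext <;> rfl
    rw [← hcomp]
    rfl
  have hCM : P₂.IsCohenMacaulayAt := by
    refine isCohenMacaulayAt_tensorProduct_of_comap_eq_bot (FractionRing (A ⧸ p))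
      (FractionRing (B ⧸ q)) P₂ (le_bot_iff.mp fun a ha => ?_) (le_bot_iff.mp fun b hb => ?_)
    · obtain ⟨a, rfl⟩ := Ideal.Quotient.mk_surjective a
      rw [Ideal.mem_bot, Ideal.Quotient.eq_zero_iff_mem, hp, hPP₁, hPP₂]
      exact ha
    · obtain ⟨b, rfl⟩ := Ideal.Quotient.mk_surjective b
      rw [Ideal.mem_bot, Ideal.Quotient.eq_zero_iff_mem, hq₁, hPP₂]
      exact hb
  obtain ⟨n, hn, hn'⟩ := hCM
  have hnoeA := IsLocalization.isNoetherianRing p.primeCompl (Localization.AtPrime p) inferInstance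
  have hnoeB := IsLocalization.isNoetherianRing q.primeCompl (Localization.AtPrime q) inferInstance
  obtain ⟨a, ha⟩ := exists_hasGrade_maximalIdeal (Localization.AtPrime p)
  obtain ⟨b, hb⟩ := exists_hasGrade_maximalIdeal (Localization.AtPrime q)
  have hgr₁ := hasGrade_localization_of_flat hf₂ g₂.toRingHom hg₂ q P₁ P₂ hq₁ hPP₂ hker₂ hb hn'
  have hgr := hasGrade_localization_of_flat hf₁ g₁.toRingHom hg₁ p P P₁ hp hPP₁ hker₁ ha hgr₁
  rw [hJ₂, Localization.AtPrime.map_eq_maximalIdeal, Localization.AtPrime.map_eq_maximalIdeal,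
    Localization.AtPrime.map_eq_maximalIdeal]
  refine ⟨?_, a + (b + n), a, b, hgr, ha, hb, ?_⟩
  · rw [height_eq_add_of_flat hf₁ g₁.toRingHom hg₁ p P P₁ hp hPP₁ hker₁,
      height_eq_add_of_flat hf₂ g₂.toRingHom hg₂ q P₁ P₂ hq₁ hPP₂ hker₂, add_assoc]
  · rw [hn]; push_cast; ring
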